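/- Fix $p\in(0,1)$. For $n\ge 1$, a placement of $n$ sensors is a vector $x\in[0,1]^n$. Each sensor fails with probability $p$, independently of the others, so a set $A\subseteq\{1,\dots,n\}$ is exactly the set of active (non-failed) sensors with probability $p^{n-|A|}(1-p)^{|A|}$. The coverage cost of $x$ when $A$ is the set of active sensors is $$C_0(x_A)=\max_{s\in[0,1]}\min_{j\in A}|s-x_j|\quad (A\neq\emptyset),\qquad C_0(x_\emptyset)=1,$$ and the expected cost of $x$ is $$C(x)=\sum_{A\subseteq\{1,\dots,n\}}p^{n-|A|}(1-p)^{|A|}\,C_0(x_A).$$ Let $x^{\mathrm{eq}}=x^{\mathrm{eq},n}=\frac1{2n}(1,3,\dots,2n-1)$ be the equispaced placement, and call $x^*\in[0,1]^n$ optimal if $C(x^*)\le C(y)$ for all $y\in[0,1]^n$. Then: 1. As $n\to\infty$ (with $p$ fixed and $\log$ the natural logarithm), $$C(x^{\mathrm{eq},n})=\frac{1}{2\log(p^{-1})}\,\frac{\log n}{n}+O\!\left(\frac1n\right).$$ 2. For every integer $n\ge 1$, an optimal placement exists, and every optimal placement $x^*\in[0,1]^n$ satisfies $$C(x^{\mathrm{eq},n})\le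 C(x^*)+\frac{p}{1-p}\cdot\frac{2}{n}.$$ 3. Consequently, if $x^{*,n}\in[0,1]^n$ is an optimal placement for each $n\ge1$, then $C(x^{\mathrm{eq},n})/C(x^{*,n})\to1$ as $n\to\infty$. -/

import Mathlib

open Filter Topology Asymptotics

namespace SensorCoverage

/-- The distance from the point `s` to the closest active sensor, where `A` is the (nonempty)
set of active sensors and sensor `j` is located at `x j`. -/
noncomputable def distToActive {n : ℕ} (x : Fin n → ℝ) (A : Finset (Fin n)) (hA : A.Nonempty)
    (s : ℝ) : ℝ :=
  A.inf' hA (fun j => |s - x j|)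

/-- The coverage cost `C₀(x_A)`: the largest distance between a point of `[0,1]` and its closest
active sensor, with the convention that the cost is `1` when no sensor is active.
By `coverageCost_isGreatest` the supremum is a maximum. -/
noncomputable def coverageCost {n : ℕ} (x : Fin n → ℝ) (A : Finset (Fin n)) : ℝ :=
  open Classical in
  if hA : A.Nonempty then sSup (distToActive x A hA '' Set.Icc 0 1) else 1

/-- The probability that `A` is exactly the set of active sensors, when each of the `n` sensors
fails with probability `p`, independently of the others. -/
noncomputable def activeProb {n : ℕ} (p : ℝ) (A : Finset (Fin n)) : ℝ :=
  p ^ (n - A.card) * (1 - p) ^ A.card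

/-- The expected coverage cost `C(x)` of the placement `x`, for failure probability `p`. -/
noncomputable def expectedCost {n : ℕ} (p : ℝ) (x : Fin n → ℝ) : ℝ :=
  ∑ A : Finset (Fin n), activeProb p A * coverageCost x A

/-- The equispaced placement `(1, 3, …, 2n - 1) / (2n)` (indices start at `0`). -/
noncomputable def equispaced (n : ℕ) : Fin n → ℝ :=
  fun i => (2 * (i : ℝ) + 1) / (2 * (n : ℝ))

/-- `x` is an optimal placement: it lies in `[0,1]ⁿ` and minimizes the expected cost over
`[0,1]ⁿ`. -/
def IsOptimalPlacement {n : ℕ} (p : ℝ) (x : Fin n → ℝ) : Prop :=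
  (∀ i, x i ∈ Set.Icc (0 : ℝ) 1) ∧
    ∀ y : Fin n → ℝ, (∀ i, y i ∈ Set.Icc (0 : ℝ) 1) → expectedCost p x ≤ expectedCost p y

/-- The supremum in the definition of the coverage cost is attained. -/
theorem coverageCost_isGreatest {n : ℕ} (x : Fin n → ℝ) (A : Finset (Fin n))
    (hA : A.Nonempty) :
    IsGreatest (distToActive x A hA '' Set.Icc 0 1) (coverageCost x A) := by
  have hc : Continuous (distToActive x A hA) := by
    unfold distToActive
    exact Continuous.finset_inf'_apply hA (fun j _ => by fun_prop)
  have h := (isCompact_Icc.image hc).isGreatest_sSup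
    ((Set.nonempty_Icc.2 (zero_le_one (α := ℝ))).image (distToActive x A hA))
  simpa only [coverageCost, dif_pos hA] using h

end SensorCoverage

namespace SensorCoverage

/-! ### Expectations over the random set of active sensors -/

/-! Every cost is compared with one quantity, `runCost`, which is essentially (M+1)/(2n), where M is
the longest run of failed sensors.

Lower bound, for any placement: sort the sensors and continue them periodically along the line
(`unroll`). A run of M failed sensors leaves a gap of M+1 index steps, and half the length of that
gap is a lower bound for the cost, even when the gap wraps around the ends of [0,1]. Rotating the
active set cyclically preserves its law, and over all n rotations these gaps add up to exactly M+1.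
Averaging gives E(`runCost`) ≤ C(x) (`expect_runCost_le`).

Upper bound, for the equispaced placement: interior gaps cost at most (M+1)/(2n), and the two ends
add at most the leading and trailing runs over 2n. Each of these runs has mean at most p/(1-p), so
the equispaced cost exceeds E(`runCost`) by O(1/n) (`expectedCost_equispaced_le`).

Finally E(M) = log n / log(1/p) + O(1): a union bound from above (`expect_longestRun_le`), a
disjointness argument on the position of the first run from below (`le_expect_longestRun`). Hence n
C tends to infinity, and an additive gap O(1/n) forces the ratio to 1. -/

/-- The expectation of `f A`, where `A` is the random set of active sensors. -/
noncomputable def expect {n : ℕ} (p : ℝ) (f : Finset (Fin n) → ℝ) : ℝ :=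
  ∑ A : Finset (Fin n), activeProb p A * f A

open Classical in
/-- The probability of the event `P`. -/
noncomputable def prob {n : ℕ} (p : ℝ) (P : Finset (Fin n) → Prop) : ℝ :=
  expect p (fun A => if P A then 1 else 0)

section Expectation

variable {n : ℕ} {p : ℝ}

theorem activeProb_nonneg (hp0 : 0 ≤ p) (hp1 : p ≤ 1) (A : Finset (Fin n)) :
    0 ≤ activeProb p A :=
  mul_nonneg (pow_nonneg hp0 _) (pow_nonneg (sub_nonneg.2 hp1) _)

theorem expect_mono (hp0 : 0 ≤ p) (hp1 : p ≤ 1) {f g : Finset (Fin n) → ℝ}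
    (h : ∀ A, f A ≤ g A) : expect p f ≤ expect p g :=
  Finset.sum_le_sum fun A _ => mul_le_mul_of_nonneg_left (h A) (activeProb_nonneg hp0 hp1 A)

theorem expect_nonneg (hp0 : 0 ≤ p) (hp1 : p ≤ 1) {f : Finset (Fin n) → ℝ}
    (h : ∀ A, 0 ≤ f A) : 0 ≤ expect p f :=
  Finset.sum_nonneg fun A _ => mul_nonneg (activeProb_nonneg hp0 hp1 A) (h A)

theorem expect_add (f g : Finset (Fin n) → ℝ) :
    expect p (fun A => f A + g A) = expect p f + expect p g := by
  simp only [expect, mul_add, Finset.sum_add_distrib]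

theorem expect_const_mul (c : ℝ) (f : Finset (Fin n) → ℝ) :
    expect p (fun A => c * f A) = c * expect p f := by
  simp only [expect, Finset.mul_sum, mul_left_comm]

theorem expect_sum {ι : Type*} (s : Finset ι) (f : ι → Finset (Fin n) → ℝ) :
    expect p (fun A => ∑ i ∈ s, f i A) = ∑ i ∈ s, expect p (f i) := by
  simp only [expect, Finset.mul_sum]
  exact Finset.sum_comm

theorem expect_equiv (e : Finset (Fin n) ≃ Finset (Fin n)) (he : ∀ A, (e A).card = A.card)
    (f : Finset (Fin n) → ℝ) : expect p (fun A => f (e A)) = expect p f := by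
  unfold expect
  rw [← e.sum_comp (fun A => activeProb p A * f A)]
  exact Finset.sum_congr rfl fun A _ => by simp [activeProb, he]

/-- Summation over all sets, grouped by the status of sensor `j`. -/
theorem expect_split (j : Fin n) (f : Finset (Fin n) → ℝ) :
    expect p f = ∑ t ∈ (Finset.univ.erase j).powerset,
      p ^ (n - 1 - t.card) * (1 - p) ^ t.card * (p * f t + (1 - p) * f (insert j t)) := by
  have hu : (Finset.univ : Finset (Finset (Fin n)))
      = (insert j (Finset.univ.erase j)).powerset := by
    rw [Finset.insert_erase (Finset.mem_univ j), Finset.powerset_univ]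
  unfold expect
  rw [hu, Finset.sum_powerset_insert (Finset.notMem_erase j _), ← Finset.sum_add_distrib]
  refine Finset.sum_congr rfl fun t ht => ?_
  have hts := Finset.mem_powerset.1 ht
  have hj : j ∉ t := fun h => Finset.notMem_erase j _ (hts h)
  have hc : t.card ≤ n - 1 := by
    simpa [Finset.card_erase_of_mem] using Finset.card_le_card hts
  have hn : 0 < n := j.pos
  have h1 : n - t.card = (n - 1 - t.card) + 1 := by omega
  have h2 : n - (t.card + 1) = n - 1 - t.card := by omega
  simp only [activeProb, Finset.card_insert_of_notMem hj]
  rw [h1, h2]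
  ring

/-- The status of sensor `j` is independent of the status of the others. -/
theorem expect_resample (j : Fin n) (f : Finset (Fin n) → ℝ) :
    expect p f = p * expect p (fun A => f (A.erase j))
      + (1 - p) * expect p (fun A => f (insert j A)) := by
  rw [expect_split j f, expect_split j (fun A => f (A.erase j)),
    expect_split j (fun A => f (insert j A)), Finset.mul_sum, Finset.mul_sum,
    ← Finset.sum_add_distrib]
  refine Finset.sum_congr rfl fun t ht => ?_
  have hj : j ∉ t := fun h => Finset.notMem_erase j _ (Finset.mem_powerset.1 ht h)
  simp only [Finset.erase_eq_of_notMem hj, Finset.erase_insert hj, Finset.insert_idem]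
  ring

theorem expect_const (c : ℝ) : expect p (fun _ : Finset (Fin n) => c) = c := by
  have h := Fintype.sum_pow_mul_eq_add_pow (Fin n) (1 - p) p
  simp only [sub_add_cancel, one_pow, Fintype.card_fin] at h
  simp only [expect, activeProb, ← Finset.sum_mul]
  simp only [mul_comm (p ^ _), h, one_mul]

theorem prob_nonneg (hp0 : 0 ≤ p) (hp1 : p ≤ 1) (P : Finset (Fin n) → Prop) : 0 ≤ prob p P :=
  expect_nonneg hp0 hp1 fun A => by split_ifs <;> norm_num

theorem prob_add_prob_not (P : Finset (Fin n) → Prop) :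
    prob p P + prob p (fun A => ¬ P A) = 1 := by
  rw [prob, prob, ← expect_add]
  refine Eq.trans ?_ (expect_const (n := n) (p := p) 1)
  congr 1
  ext A
  by_cases h : P A <;> simp [h]

/-- All sensors of `W` fail with probability `p ^ |W|`. -/
theorem prob_disjoint (W : Finset (Fin n)) : prob p (fun A => Disjoint W A) = p ^ W.card := by
  induction W using Finset.induction_on with
  | empty => simp [prob, expect_const]
  | insert j W hj ih =>
    rw [prob, expect_resample j, Finset.card_insert_of_notMem hj, pow_succ', ← ih, prob]
    have h1 : ∀ A : Finset (Fin n), Disjoint (insert j W) (A.erase j) ↔ Disjoint W A := by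
      intro A
      rw [Finset.disjoint_insert_left, ← Finset.disjoint_erase_comm, Finset.erase_eq_of_notMem hj]
      simp
    simp only [h1, Finset.disjoint_insert_left, Finset.mem_insert_self, not_true_eq_false,
      false_and, if_false, expect_const, mul_zero, add_zero]
    congr!

/-- Independently of the rest, all of W fails with probability p^|W|, and then A equals A \ W; the
other outcomes contribute nonnegatively. With `expect_insert_le` this forces chosen statuses at a
multiplicative price. -/
theorem expect_sdiff_le (hp0 : 0 ≤ p) (hp1 : p ≤ 1) {f : Finset (Fin n) → ℝ}
    (hf : ∀ A, 0 ≤ f A) (W : Finset (Fin n)) :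
    p ^ W.card * expect p (fun A => f (A \ W)) ≤ expect p f := by
  induction W using Finset.induction_on with
  | empty => simp
  | insert j W hj ih =>
    refine le_trans ?_ ih
    rw [Finset.card_insert_of_notMem hj, pow_succ, mul_assoc]
    refine mul_le_mul_of_nonneg_left ?_ (pow_nonneg hp0 _)
    rw [expect_resample j (fun A => f (A \ W))]
    have h : ∀ A : Finset (Fin n), A \ insert j W = A.erase j \ W := by
      intro A; ext x; simp only [Finset.mem_sdiff, Finset.mem_insert, Finset.mem_erase]; tauto
    simp only [h]
    exact le_add_of_nonneg_right (mul_nonneg (sub_nonneg.2 hp1)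
      (expect_nonneg hp0 hp1 fun A => hf _))

theorem expect_insert_le (hp0 : 0 ≤ p) (hp1 : p ≤ 1) {f : Finset (Fin n) → ℝ}
    (hf : ∀ A, 0 ≤ f A) (j : Fin n) :
    (1 - p) * expect p (fun A => f (insert j A)) ≤ expect p f := by
  rw [expect_resample j f]
  exact le_add_of_nonneg_left (mul_nonneg hp0 (expect_nonneg hp0 hp1 fun A => hf _))

end Expectation

/-! ### Runs of failed sensors -/

/-- The sensors with indices in `[a, a + k)`. -/
def window (n a k : ℕ) : Finset (Fin n) :=
  Finset.univ.filter fun j => a ≤ (j : ℕ) ∧ (j : ℕ) < a + k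

/-- There are `k` consecutive failed sensors. -/
def HasRun {n : ℕ} (A : Finset (Fin n)) (k : ℕ) : Prop :=
  ∃ a, a + k ≤ n ∧ Disjoint (window n a k) A

open Classical in
/-- The largest number of consecutive failed sensors. -/
noncomputable def longestRun {n : ℕ} (A : Finset (Fin n)) : ℕ :=
  ((Finset.Icc 1 n).filter (HasRun A)).card

open Classical in
/-- The number of failed sensors before the first active one. -/
noncomputable def leadingRun {n : ℕ} (A : Finset (Fin n)) : ℕ :=
  ((Finset.Icc 1 n).filter fun k => Disjoint (window n 0 k) A).card

open Classical in
/-- The number of failed sensors after the last active one. -/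
noncomputable def trailingRun {n : ℕ} (A : Finset (Fin n)) : ℕ :=
  ((Finset.Icc 1 n).filter fun k => Disjoint (window n (n - k) k) A).card

section Runs

variable {n : ℕ} {p : ℝ} {A : Finset (Fin n)}

theorem mem_window {a k : ℕ} {j : Fin n} : j ∈ window n a k ↔ a ≤ (j : ℕ) ∧ (j : ℕ) < a + k := by
  simp [window]

theorem disjoint_window {a k : ℕ} :
    Disjoint (window n a k) A ↔ ∀ j ∈ A, (j : ℕ) < a ∨ a + k ≤ j := by
  simp only [Finset.disjoint_right, mem_window]
  exact forall₂_congr fun j _ => by omega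

theorem card_window {a k : ℕ} (h : a + k ≤ n) : (window n a k).card = k := by
  have : window n a k = Finset.attachFin (Finset.Ico a (a + k))
      (fun m hm => by rw [Finset.mem_Ico] at hm; omega) := by
    ext j; simp [mem_window]
  rw [this, Finset.card_attachFin, Nat.card_Ico]
  omega

theorem HasRun.mono {k l : ℕ} (h : HasRun A l) (hkl : k ≤ l) : HasRun A k := by
  obtain ⟨a, ha, hd⟩ := h
  rw [disjoint_window] at hd
  exact ⟨a, by omega, disjoint_window.2 fun j hj => by have := hd j hj; omega⟩

theorem le_card_filter_Icc {P : ℕ → Prop} [DecidablePred P] {l : ℕ} (hl : l ≤ n)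
    (h : ∀ k ≤ l, P k) : l ≤ ((Finset.Icc 1 n).filter P).card := by
  calc l = (Finset.Icc 1 l).card := by simp
    _ ≤ _ := Finset.card_le_card fun k hk => by
      rw [Finset.mem_Icc] at hk
      exact Finset.mem_filter.2 ⟨Finset.mem_Icc.2 ⟨hk.1, by omega⟩, h k hk.2⟩

theorem le_longestRun {l : ℕ} (h : HasRun A l) : l ≤ longestRun A := by
  classical
  exact le_card_filter_Icc (by obtain ⟨a, ha, -⟩ := h; omega) fun _ hk => h.mono hk

theorem hasRun_longestRun (A : Finset (Fin n)) : HasRun A (longestRun A) := by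
  classical
  by_contra h
  have hM : longestRun A ≠ 0 := by
    intro h0
    rw [h0] at h
    exact h ⟨0, by omega, disjoint_window.2 fun j _ => by omega⟩
  have hsub : (Finset.Icc 1 n).filter (HasRun A) ⊆ Finset.Icc 1 (longestRun A - 1) := by
    intro k hk
    rw [Finset.mem_filter, Finset.mem_Icc] at hk
    have : ¬ longestRun A ≤ k := fun hle => h (hk.2.mono hle)
    rw [Finset.mem_Icc]
    omega
  have := Finset.card_le_card hsub
  rw [Nat.card_Icc] at this
  have h2 : longestRun A = ((Finset.Icc 1 n).filter (HasRun A)).card := by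
    unfold longestRun; congr
  omega

theorem le_leadingRun {l : ℕ} (hl : l ≤ n) (h : Disjoint (window n 0 l) A) :
    l ≤ leadingRun A := by
  classical
  refine le_card_filter_Icc hl fun k hk => ?_
  rw [disjoint_window] at h ⊢
  intro j hj
  have := h j hj
  omega

theorem le_trailingRun {l : ℕ} (hl : l ≤ n) (h : Disjoint (window n (n - l) l) A) :
    l ≤ trailingRun A := by
  classical
  refine le_card_filter_Icc hl fun k hk => ?_
  rw [disjoint_window] at h ⊢
  intro j hj
  have := h j hj
  have := j.2
  omega

theorem longestRun_empty : longestRun (∅ : Finset (Fin n)) = n := by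
  classical
  refine le_antisymm ?_ (le_longestRun ⟨0, by omega, by simp⟩)
  exact (Finset.card_filter_le _ _).trans (by simp)

/-! ### Expected run lengths -/

/-- This is why run lengths are defined by counting admissible k: the tail-sum formula for the
expectation becomes linearity. -/
theorem expect_card_filter_Icc (P : ℕ → Finset (Fin n) → Prop)
    [∀ A, DecidablePred fun k => P k A] :
    expect p (fun A => (((Finset.Icc 1 n).filter fun k => P k A).card : ℝ))
      = ∑ k ∈ Finset.Icc 1 n, prob p (P k) := by
  simp only [prob, ← expect_sum]
  congr 1
  ext A
  rw [Finset.card_filter]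
  push_cast
  exact Finset.sum_congr rfl fun k _ => by congr

theorem sum_pow_Icc_le (hp0 : 0 ≤ p) (hp1 : p < 1) (K m : ℕ) :
    ∑ k ∈ Finset.Icc (K + 1) m, p ^ k ≤ p ^ (K + 1) / (1 - p) := by
  rw [← Finset.Ico_add_one_right_eq_Icc]
  exact geom_sum_Ico_le_of_lt_one hp0 hp1

theorem expect_leadingRun_le (hp0 : 0 ≤ p) (hp1 : p < 1) :
    expect p (fun A : Finset (Fin n) => (leadingRun A : ℝ)) ≤ p / (1 - p) := by
  classical
  unfold leadingRun
  rw [expect_card_filter_Icc (fun k A => Disjoint (window n 0 k) A)]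
  refine le_trans (Finset.sum_le_sum fun k hk => ?_)
    ((sum_pow_Icc_le hp0 hp1 0 n).trans_eq (by simp))
  rw [prob_disjoint, card_window (by rw [Finset.mem_Icc] at hk; omega)]

theorem expect_trailingRun_le (hp0 : 0 ≤ p) (hp1 : p < 1) :
    expect p (fun A : Finset (Fin n) => (trailingRun A : ℝ)) ≤ p / (1 - p) := by
  classical
  unfold trailingRun
  rw [expect_card_filter_Icc (fun k A => Disjoint (window n (n - k) k) A)]
  refine le_trans (Finset.sum_le_sum fun k hk => ?_)
    ((sum_pow_Icc_le hp0 hp1 0 n).trans_eq (by simp))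
  rw [prob_disjoint, card_window (by rw [Finset.mem_Icc] at hk; omega)]

theorem expect_longestRun :
    expect p (fun A : Finset (Fin n) => (longestRun A : ℝ))
      = ∑ k ∈ Finset.Icc 1 n, prob p (fun A : Finset (Fin n) => HasRun A k) := by
  classical
  exact expect_card_filter_Icc (fun k A => HasRun A k)

theorem prob_le_one (hp0 : 0 ≤ p) (hp1 : p ≤ 1) (P : Finset (Fin n) → Prop) : prob p P ≤ 1 := by
  have := prob_nonneg hp0 hp1 fun A => ¬ P A
  linarith [prob_add_prob_not (p := p) P]

theorem prob_hasRun_le (hp0 : 0 ≤ p) (hp1 : p ≤ 1) {k : ℕ} (hk : 1 ≤ k) :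
    prob p (fun A : Finset (Fin n) => HasRun A k) ≤ n * p ^ k := by
  classical
  rcases Nat.lt_or_ge n k with h | h
  · have : ∀ A : Finset (Fin n), ¬ HasRun A k := by rintro A ⟨a, ha, -⟩; omega
    simp only [prob, this, if_false, expect_const]
    positivity
  calc prob p (fun A : Finset (Fin n) => HasRun A k)
      ≤ expect p (fun A : Finset (Fin n) => ∑ a ∈ Finset.range (n + 1 - k),
          if Disjoint (window n a k) A then (1 : ℝ) else 0) := by
        refine expect_mono hp0 hp1 fun A => ?_
        split_ifs with hA
        · obtain ⟨a, ha, hd⟩ := hA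
          have hmem : a ∈ Finset.range (n + 1 - k) := Finset.mem_range.2 (by omega)
          refine le_trans ?_ (Finset.single_le_sum (fun i _ => ?_) hmem)
          · simp [hd]
          · split_ifs <;> norm_num
        · exact Finset.sum_nonneg fun i _ => by split_ifs <;> norm_num
    _ = ∑ a ∈ Finset.range (n + 1 - k), prob p (fun A => Disjoint (window n a k) A) := by
        rw [expect_sum]
        refine Finset.sum_congr rfl fun a _ => ?_
        unfold prob
        congr 1
        ext A
        congr
    _ = ∑ a ∈ Finset.range (n + 1 - k), p ^ k := by
        refine Finset.sum_congr rfl fun a ha => ?_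
        rw [prob_disjoint, card_window (by rw [Finset.mem_range] at ha; omega)]
    _ ≤ n * p ^ k := by
        rw [Finset.sum_const, Finset.card_range, nsmul_eq_mul]
        have : ((n + 1 - k : ℕ) : ℝ) ≤ n := by exact_mod_cast (by omega)
        gcongr

/-- In the tail sum the first K probabilities are bounded by 1 and the rest by the union bound, a
geometric series. -/
theorem expect_longestRun_le (hp0 : 0 ≤ p) (hp1 : p < 1) (K : ℕ) :
    expect p (fun A : Finset (Fin n) => (longestRun A : ℝ)) ≤ K + n * p ^ (K + 1) / (1 - p) := by
  rw [expect_longestRun]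
  calc ∑ k ∈ Finset.Icc 1 n, prob p (fun A : Finset (Fin n) => HasRun A k)
      ≤ ∑ k ∈ Finset.Icc 1 K ∪ Finset.Icc (K + 1) n,
          prob p (fun A : Finset (Fin n) => HasRun A k) := by
        refine Finset.sum_le_sum_of_subset_of_nonneg (fun k hk => ?_)
          fun k _ _ => prob_nonneg hp0 hp1.le _
        simp only [Finset.mem_union, Finset.mem_Icc] at hk ⊢
        omega
    _ = ∑ k ∈ Finset.Icc 1 K, prob p (fun A : Finset (Fin n) => HasRun A k)
        + ∑ k ∈ Finset.Icc (K + 1) n, prob p (fun A : Finset (Fin n) => HasRun A k) := by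
        refine Finset.sum_union (Finset.disjoint_left.2 fun k hk hk' => ?_)
        rw [Finset.mem_Icc] at hk hk'
        omega
    _ ≤ ∑ k ∈ Finset.Icc 1 K, (1 : ℝ) + ∑ k ∈ Finset.Icc (K + 1) n, n * p ^ k := by
        refine add_le_add (Finset.sum_le_sum fun k _ => prob_le_one hp0 hp1.le _)
          (Finset.sum_le_sum fun k hk => prob_hasRun_le hp0 hp1.le ?_)
        rw [Finset.mem_Icc] at hk
        omega
    _ ≤ K + n * p ^ (K + 1) / (1 - p) := by
        rw [← Finset.mul_sum, mul_div_assoc]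
        refine add_le_add (by simp) (mul_le_mul_of_nonneg_left
          (sum_pow_Icc_le hp0 hp1 K n) (Nat.cast_nonneg n))

/-- The first run of `k` failed sensors starts right after the active sensor `i`. -/
def FirstRunAfter (A : Finset (Fin n)) (k : ℕ) (i : Fin n) : Prop :=
  (∀ a, a + k ≤ i → ¬ Disjoint (window n a k) A) ∧ i ∈ A ∧ Disjoint (window n (i + 1) k) A

/-- If i < j, the active sensor j lies beyond the failed window after i, so that window is a run
ending before j, contradicting minimality at j. -/
theorem FirstRunAfter.eq {k : ℕ} {i j : Fin n} (hi : FirstRunAfter A k i)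
    (hj : FirstRunAfter A k j) : i = j := by
  wlog h : i < j generalizing i j
  · rcases lt_trichotomy i j with h' | h' | h'
    · exact absurd h' h
    · exact h'
    · exact (this hj hi h').symm
  exfalso
  have h' : (i : ℕ) < j := h
  rcases disjoint_window.1 hi.2.2 j hj.2.1 with h1 | h1
  · omega
  · exact hj.1 _ h1 hi.2.2

/-- Take a configuration without a run, make i active and the next k sensors fail: the first run now
starts right after i. So each of these n - k events has probability at least (1-p) p^k times that of
having no run. They are disjoint from each other and from the absence of a run, so the total is at
most 1. -/
theorem prob_not_hasRun_mul_le (hp0 : 0 ≤ p) (hp1 : p ≤ 1) {k : ℕ} (hk : k ≤ n) :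
    prob p (fun A : Finset (Fin n) => ¬ HasRun A k) * (1 + ((n : ℝ) - k) * ((1 - p) * p ^ k))
      ≤ 1 := by
  classical
  set N := prob p (fun A : Finset (Fin n) => ¬ HasRun A k)
  have hD : ∀ i ∈ window n 0 (n - k),
      (1 - p) * p ^ k * N ≤ prob p (fun A : Finset (Fin n) => FirstRunAfter A k i) := by
    intro i hi
    rw [mem_window] at hi
    have h0 : ∀ A : Finset (Fin n), (0 : ℝ) ≤ if FirstRunAfter A k i then (1 : ℝ) else 0 := by
      intro A; split_ifs <;> norm_num
    have h1 := expect_sdiff_le hp0 hp1 h0 (window n (i + 1) k)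
    rw [card_window (by omega)] at h1
    have h2 := expect_insert_le (f := fun A => if FirstRunAfter (A \ window n (i + 1) k) k i
      then (1 : ℝ) else 0) hp0 hp1 (fun A => h0 _) i
    have h3 : N ≤ expect p (fun A => if FirstRunAfter (insert i A \ window n (i + 1) k) k i
        then (1 : ℝ) else 0) := by
      refine expect_mono hp0 hp1 fun A => ?_
      by_cases hA : HasRun A k
      · simpa [hA] using h0 _
      · rw [if_pos hA, if_pos]
        refine ⟨fun a ha hd => hA ⟨a, by omega, ?_⟩, ?_, Finset.disjoint_sdiff⟩
        · rw [disjoint_window] at hd ⊢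
          intro j hj
          by_cases hjw : j ∈ window n (i + 1) k
          · rw [mem_window] at hjw
            omega
          · exact hd j (Finset.mem_sdiff.2 ⟨Finset.mem_insert_of_mem hj, hjw⟩)
        · simp [mem_window]
    calc (1 - p) * p ^ k * N = p ^ k * ((1 - p) * N) := by ring
      _ ≤ p ^ k * ((1 - p) * _) := by
        have := sub_nonneg.2 hp1
        gcongr
      _ ≤ p ^ k * _ := mul_le_mul_of_nonneg_left h2 (pow_nonneg hp0 _)
      _ ≤ expect p _ := h1
      _ = _ := by unfold prob; congr
  have hsum : N + ∑ i ∈ window n 0 (n - k), prob p (fun A => FirstRunAfter A k i) ≤ 1 := by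
    simp only [N, prob]
    rw [← expect_sum, ← expect_add]
    refine le_trans (expect_mono hp0 hp1 (g := fun _ => 1) fun A => ?_) (expect_const 1).le
    rw [Finset.sum_boole]
    by_cases hA : HasRun A k
    · simp only [hA, not_true_eq_false, if_false, zero_add, Nat.cast_le_one]
      refine Finset.card_le_one.2 fun i hi j hj => ?_
      exact (Finset.mem_filter.1 hi).2.eq (Finset.mem_filter.1 hj).2
    · rw [Finset.filter_false_of_mem]
      · simp [hA]
      · intro i hi hF
        rw [mem_window] at hi
        exact hA ⟨i + 1, by omega, hF.2.2⟩
  have := Finset.card_nsmul_le_sum _ _ _ hD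
  rw [card_window (by omega), nsmul_eq_mul, Nat.cast_sub hk] at this
  linarith

theorem le_expect_longestRun (hp0 : 0 < p) (hp1 : p < 1) {K : ℕ} (hK : 2 * K ≤ n) :
    K - 2 * (p⁻¹) ^ K / (n * (1 - p) ^ 2)
      ≤ expect p (fun A : Finset (Fin n) => (longestRun A : ℝ)) := by
  rcases Nat.eq_zero_or_pos n with rfl | hn
  · obtain rfl : K = 0 := by omega
    simpa using expect_nonneg hp0.le hp1.le fun A : Finset (Fin 0) => Nat.cast_nonneg (longestRun A)
  have hq : 0 < 1 - p := sub_pos.2 hp1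
  have hn' : (0 : ℝ) < n := Nat.cast_pos.2 hn
  have hk : ∀ k ∈ Finset.Icc 1 K, 1 - 2 / (n * (1 - p)) * p⁻¹ ^ k
      ≤ prob p (fun A : Finset (Fin n) => HasRun A k) := by
    intro k hk
    rw [Finset.mem_Icc] at hk
    have h := prob_not_hasRun_mul_le (n := n) (k := k) hp0.le hp1.le (by omega)
    have h1 := prob_add_prob_not (p := p) (fun A : Finset (Fin n) => HasRun A k)
    have h0 := prob_nonneg hp0.le hp1.le (fun A : Finset (Fin n) => ¬ HasRun A k)
    set N := prob p (fun A : Finset (Fin n) => ¬ HasRun A k)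
    -- Here k ≤ K ≤ n/2, so at least half of the positions remain.
    have hkn : (n : ℝ) / 2 ≤ (n : ℝ) - k := by
      have : (2 : ℝ) * k ≤ n := by exact_mod_cast (by omega)
      linarith
    have hle : N * ((n : ℝ) / 2 * ((1 - p) * p ^ k)) ≤ 1 := by
      refine le_trans (mul_le_mul_of_nonneg_left ?_ h0) h
      have : (n : ℝ) / 2 * ((1 - p) * p ^ k) ≤ ((n : ℝ) - k) * ((1 - p) * p ^ k) := by gcongr
      linarith
    have : N ≤ 2 / (n * (1 - p)) * p⁻¹ ^ k := by
      rw [← le_div_iff₀ (by positivity)] at hle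
      refine hle.trans_eq ?_
      rw [inv_pow]
      field_simp
    linarith
  -- An increasing geometric sum is comparable to its last term.
  have hgeom : ∑ k ∈ Finset.Icc 1 K, p⁻¹ ^ k ≤ p⁻¹ ^ K / (1 - p) := by
    clear hk hK
    induction K with
    | zero => simpa using hp1.le
    | succ K ih =>
      rw [Finset.sum_Icc_succ_top (by omega)]
      refine (add_le_add_left ih _).trans_eq ?_
      rw [pow_succ]
      field_simp
      ring
  rw [expect_longestRun]
  calc K - 2 * (p⁻¹) ^ K / (n * (1 - p) ^ 2)
      = K - 2 / (n * (1 - p)) * (p⁻¹ ^ K / (1 - p)) := by field_simp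
    _ ≤ K - 2 / (n * (1 - p)) * ∑ k ∈ Finset.Icc 1 K, p⁻¹ ^ k := by gcongr
    _ = ∑ k ∈ Finset.Icc 1 K, (1 - 2 / (n * (1 - p)) * p⁻¹ ^ k) := by
        rw [Finset.sum_sub_distrib, Finset.mul_sum]; simp
    _ ≤ ∑ k ∈ Finset.Icc 1 K, prob p (fun A : Finset (Fin n) => HasRun A k) :=
        Finset.sum_le_sum hk
    _ ≤ _ := Finset.sum_le_sum_of_subset_of_nonneg
        (Finset.Icc_subset_Icc_right (by omega)) fun k _ _ => prob_nonneg hp0.le hp1.le _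

end Runs

/-! ### The coverage cost -/

section Cost

variable {n : ℕ} {p : ℝ} {x : Fin n → ℝ} {A : Finset (Fin n)}

theorem le_coverageCost (hA : A.Nonempty) {s c : ℝ} (hs : s ∈ Set.Icc (0 : ℝ) 1)
    (h : ∀ j ∈ A, c ≤ |s - x j|) : c ≤ coverageCost x A :=
  (Finset.le_inf' hA _ h).trans ((coverageCost_isGreatest x A hA).2 (Set.mem_image_of_mem _ hs))

theorem coverageCost_le (hA : A.Nonempty) {c : ℝ}
    (h : ∀ s ∈ Set.Icc (0 : ℝ) 1, ∃ j ∈ A, |s - x j| ≤ c) : coverageCost x A ≤ c := by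
  obtain ⟨s, hs, he⟩ := (coverageCost_isGreatest x A hA).1
  obtain ⟨j, hj, hjc⟩ := h s hs
  rw [← he]
  exact (Finset.inf'_le _ hj).trans hjc

theorem coverageCost_empty : coverageCost x ∅ = 1 := by simp [coverageCost]

theorem expectedCost_eq_expect : expectedCost p x = expect p (coverageCost x) := rfl

theorem continuous_coverageCost (A : Finset (Fin n)) :
    Continuous fun x : Fin n → ℝ => coverageCost x A := by
  by_cases hA : A.Nonempty
  · simp only [coverageCost, dif_pos hA]
    refine isCompact_Icc.continuous_sSup ?_
    exact Continuous.finset_inf'_apply hA fun j _ => by fun_prop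
  · simpa only [coverageCost, dif_neg hA] using continuous_const

theorem exists_isOptimalPlacement (p : ℝ) (n : ℕ) :
    ∃ x : Fin n → ℝ, IsOptimalPlacement p x := by
  have hcont : Continuous fun x : Fin n → ℝ => expectedCost p x :=
    continuous_finsetSum _ fun A _ => continuous_const.mul (continuous_coverageCost A)
  have hK : IsCompact (Set.univ.pi fun _ : Fin n => Set.Icc (0 : ℝ) 1) :=
    isCompact_univ_pi fun _ => isCompact_Icc
  obtain ⟨x, hx, hmin⟩ := hK.exists_isMinOn ⟨fun _ => 0, fun _ _ => by simp⟩ hcont.continuousOn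
  exact ⟨x, fun i => hx i trivial, fun y hy => hmin fun i _ => hy i⟩

theorem coverageCost_comp_perm (σ : Equiv.Perm (Fin n)) (A : Finset (Fin n)) :
    coverageCost (x ∘ σ) A = coverageCost x (σ.finsetCongr A) := by
  by_cases hA : A.Nonempty
  · have hA' : (σ.finsetCongr A).Nonempty := by simpa using hA
    simp only [coverageCost, dif_pos hA, dif_pos hA']
    congr 2
    ext s
    simp [distToActive, Finset.inf'_map]
  · rw [Finset.not_nonempty_iff_eq_empty.1 hA]
    simp [coverageCost]

/-- Sensors are exchangeable, so placements may be assumed sorted. -/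
theorem expectedCost_comp_perm (σ : Equiv.Perm (Fin n)) :
    expectedCost p (x ∘ σ) = expectedCost p x := by
  rw [expectedCost_eq_expect, expectedCost_eq_expect,
    ← expect_equiv σ.finsetCongr (by simp) (coverageCost x)]
  exact congrArg _ (funext fun A => coverageCost_comp_perm σ A)

/-! ### The lower bound for all placements -/

/-- The placement `x` continued along the real line with period `1`. -/
noncomputable def unroll (x : Fin n → ℝ) (hn : 0 < n) (t : ℕ) : ℝ :=
  x ⟨t % n, Nat.mod_lt t hn⟩ + (t / n : ℕ)

theorem unroll_add_self (hn : 0 < n) (t : ℕ) : unroll x hn (t + n) = unroll x hn t + 1 := by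
  simp only [unroll, Nat.add_mod_right, Nat.add_div_right t hn]
  push_cast
  ring

theorem unroll_add_mul (hn : 0 < n) (t k : ℕ) :
    unroll x hn (t + n * k) = unroll x hn t + k := by
  simp only [unroll, Nat.add_mul_mod_self_left, Nat.add_mul_div_left t k hn]
  push_cast
  ring

/-- Half of a cyclic gap without active sensors is a lower bound for the coverage cost. -/
theorem unroll_sub_le_coverageCost (hx : ∀ i, x i ∈ Set.Icc (0 : ℝ) 1) (hmono : Monotone x)
    (hA : A.Nonempty) (hn : 0 < n) {c l : ℕ} (hl : l ≤ n)
    (h : ∀ t, 0 < t → t < l → (⟨(c + t) % n, Nat.mod_lt _ hn⟩ : Fin n) ∉ A) :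
    (unroll x hn (c + l) - unroll x hn c) / 2 ≤ coverageCost x A := by
  -- Shifting c by a multiple of n moves both ends of the gap equally.
  wlog hc : c < n generalizing c
  · have h1 := @this (c % n) (fun t h0 h1 => by simpa using h t h0 h1) (Nat.mod_lt c hn)
    have e1 : c = c % n + n * (c / n) := (Nat.mod_add_div c n).symm
    have e2 : c + l = c % n + l + n * (c / n) := by omega
    have e3 : unroll x hn c = unroll x hn (c % n) + (c / n : ℕ) := by
      rw [← unroll_add_mul, ← e1]
    rw [e2, unroll_add_mul, e3]
    linarith
  have hj : ∀ j ∈ A, ¬ (c < (j : ℕ) ∧ (j : ℕ) < c + l) := by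
    rintro j hj ⟨h1, h2⟩
    refine h (j - c) (by omega) (by omega) ?_
    convert hj
    rw [Nat.add_sub_cancel' h1.le, Nat.mod_eq_of_lt j.2]
  have hXc : unroll x hn c = x ⟨c, hc⟩ := by
    simp [unroll, Nat.mod_eq_of_lt hc, Nat.div_eq_of_lt hc]
  rcases Nat.lt_or_ge (c + l) n with hlt | hge
  · have hXl : unroll x hn (c + l) = x ⟨c + l, hlt⟩ := by
      simp [unroll, Nat.mod_eq_of_lt hlt, Nat.div_eq_of_lt hlt]
    rw [hXc, hXl]
    have h1 := hx ⟨c, hc⟩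
    have h2 := hx ⟨c + l, hlt⟩
    -- The midpoint of the gap is far from every active sensor.
    refine le_coverageCost hA (s := (x ⟨c, hc⟩ + x ⟨c + l, hlt⟩) / 2)
      ⟨by linarith [h1.1, h2.1], by linarith [h1.2, h2.2]⟩ fun j hjA => ?_
    rcases Nat.lt_or_ge c j with hcj | hcj
    · have : x ⟨c + l, hlt⟩ ≤ x j := hmono (Fin.mk_le_of_le_val (by have := hj j hjA; omega))
      rw [le_abs]; right; linarith
    · have : x j ≤ x ⟨c, hc⟩ := hmono hcj
      rw [le_abs]; left; linarith
  · have hlt : c + l - n < n := by omega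
    have hXl : unroll x hn (c + l) = x ⟨c + l - n, hlt⟩ + 1 := by
      rw [show unroll x hn (c + l) = unroll x hn (c + l - n + n) by
        rw [Nat.sub_add_cancel hge], unroll_add_self]
      simp [unroll, Nat.mod_eq_of_lt hlt, Nat.div_eq_of_lt hlt]
    -- The gap wraps around: its length is the part next to 0 plus the part next to 1, and the
    -- points 0 and 1 show that each part is at most the cost.
    have hleft : x ⟨c + l - n, hlt⟩ ≤ coverageCost x A := by
      refine le_coverageCost hA (s := 0) (by simp) fun j hjA => ?_
      have hle : c + l - n ≤ j := by
        by_contra hlt'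
        refine h (j + n - c) (by omega) (by omega) ?_
        convert hjA
        rw [Nat.add_sub_cancel' (by omega), Nat.add_mod_right, Nat.mod_eq_of_lt j.2]
      rw [zero_sub, abs_neg]
      exact (hmono (Fin.mk_le_of_le_val hle)).trans (le_abs_self _)
    have hright : 1 - x ⟨c, hc⟩ ≤ coverageCost x A := by
      refine le_coverageCost hA (s := 1) (by simp) fun j hjA => ?_
      have hle : (j : ℕ) ≤ c := by
        have := hj j hjA
        have := j.2
        omega
      have : x j ≤ x ⟨c, hc⟩ := hmono hle
      exact le_trans (by linarith) (le_abs_self _)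
    rw [hXc, hXl]
    linarith

/-- Cut each gap into l one-step gaps; for a fixed offset, n consecutive one-step gaps go once
around the circle and add up to 1. -/
theorem sum_unroll_sub (hn : 0 < n) (c l : ℕ) :
    ∑ r ∈ Finset.range n, (unroll x hn (c + r + l) - unroll x hn (c + r)) = l := by
  have h1 : ∀ r, unroll x hn (c + r + l) - unroll x hn (c + r)
      = ∑ t ∈ Finset.range l, (unroll x hn (c + r + (t + 1)) - unroll x hn (c + r + t)) :=
    fun r => (Finset.sum_range_sub (fun t => unroll x hn (c + r + t)) l).symm
  have h2 : ∀ t, ∑ r ∈ Finset.range n,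
      (unroll x hn (c + r + (t + 1)) - unroll x hn (c + r + t)) = 1 := by
    intro t
    have h := Finset.sum_range_sub (fun r => unroll x hn (c + t + r)) n
    rw [unroll_add_self, add_zero, add_sub_cancel_left] at h
    rw [← h]
    refine Finset.sum_congr rfl fun r _ => ?_
    rw [show c + r + (t + 1) = c + t + (r + 1) by omega, show c + r + t = c + t + r by omega]
  simp only [h1]
  rw [Finset.sum_comm, Finset.sum_congr rfl fun t _ => h2 t]
  simp

/-- The cyclic rotation by `r` of sets of sensors. -/
def rotate (hn : 0 < n) (r : ℕ) : Equiv.Perm (Fin n) :=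
  haveI : NeZero n := ⟨hn.ne'⟩
  Equiv.addRight (Fin.ofNat n r)

theorem val_rotate (hn : 0 < n) (r : ℕ) (j : Fin n) :
    (rotate hn r j : ℕ) = (j + r) % n := by
  have : NeZero n := ⟨hn.ne'⟩
  simp [rotate, Fin.val_add, Fin.ofNat]

theorem longestRun_le_sum_coverageCost (hx : ∀ i, x i ∈ Set.Icc (0 : ℝ) 1) (hmono : Monotone x)
    (hA : A.Nonempty) (hn : 0 < n) :
    ((longestRun A : ℝ) + 1) / 2
      ≤ ∑ r ∈ Finset.range n, coverageCost x ((rotate hn r).finsetCongr A) := by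
  obtain ⟨i, hi, hd⟩ := hasRun_longestRun A
  set M := longestRun A
  rw [disjoint_window] at hd
  have hM : M + 1 ≤ n := by
    obtain ⟨j, hj⟩ := hA
    have := hd j hj
    have := j.2
    omega
  calc ((M : ℝ) + 1) / 2
      -- The base index is i - 1, the sensor preceding the run, shifted by n to avoid truncated
      -- subtraction.
      = (∑ r ∈ Finset.range n, (unroll x hn (i + n - 1 + r + (M + 1))
          - unroll x hn (i + n - 1 + r))) / 2 := by rw [sum_unroll_sub]; push_cast; ring
    _ = ∑ r ∈ Finset.range n, (unroll x hn (i + n - 1 + r + (M + 1))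
          - unroll x hn (i + n - 1 + r)) / 2 := by rw [Finset.sum_div]
    _ ≤ _ := by
      refine Finset.sum_le_sum fun r _ => ?_
      refine unroll_sub_le_coverageCost hx hmono (by simpa using hA) hn hM fun t h0 h1 hmem => ?_
      rw [Equiv.finsetCongr_apply, Finset.mem_map] at hmem
      obtain ⟨j, hj, he⟩ := hmem
      have he' : ((j : ℕ) + r) % n = (i + n - 1 + r + t) % n := by
        rw [← val_rotate hn]
        exact congrArg Fin.val he
      have h3 : (j : ℕ) ≡ i + t - 1 [MOD n] := by
        refine Nat.ModEq.add_right_cancel' (r + n) ?_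
        rw [← add_assoc, ← add_assoc]
        refine (Nat.add_mod_right _ _).trans (he'.trans ?_)
        congr 1
        omega
      have h4 : (j : ℕ) = i + t - 1 := h3.eq_of_lt_of_lt j.2 (by omega)
      have := hd j hj
      omega

open Classical in
/-- A lower bound for the average of the coverage cost over all rotations of `A`. -/
noncomputable def runCost (A : Finset (Fin n)) : ℝ :=
  if A.Nonempty then ((longestRun A : ℝ) + 1) / (2 * n) else 1

theorem expect_runCost_le (hp0 : 0 ≤ p) (hp1 : p ≤ 1) (hn : 0 < n)
    (hx : ∀ i, x i ∈ Set.Icc (0 : ℝ) 1) : expect p (runCost (n := n)) ≤ expectedCost p x := by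
  wlog hmono : Monotone x generalizing x
  · rw [← expectedCost_comp_perm (Tuple.sort x)]
    exact this (fun i => hx _) (Tuple.monotone_sort x)
  have hn' : (0 : ℝ) < n := Nat.cast_pos.2 hn
  have key : expect p (fun A : Finset (Fin n) => n * runCost A) ≤ expect p (fun A =>
      ∑ r ∈ Finset.range n, coverageCost x ((rotate hn r).finsetCongr A)) := by
    refine expect_mono hp0 hp1 fun A => ?_
    by_cases hA : A.Nonempty
    · refine le_trans (le_of_eq ?_) (longestRun_le_sum_coverageCost hx hmono hA hn)
      rw [runCost, if_pos hA]
      field_simp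
    · rw [Finset.not_nonempty_iff_eq_empty.1 hA]
      simp [runCost, coverageCost_empty]
  -- Rotations preserve cardinality, hence the law of A, so all n terms on the right equal the
  -- expected cost.
  rw [expect_const_mul, expect_sum] at key
  have hrot : ∀ r ∈ Finset.range n, expect p (fun A =>
      coverageCost x ((rotate hn r).finsetCongr A)) = expectedCost p x :=
    fun r _ => expect_equiv (rotate hn r).finsetCongr (by simp) (coverageCost x)
  rw [Finset.sum_congr rfl hrot] at key
  simpa [hn'] using key

/-! ### The equispaced placement -/

theorem equispaced_mem_Icc (i : Fin n) : equispaced n i ∈ Set.Icc (0 : ℝ) 1 := by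
  have hn : (0 : ℝ) < n := Nat.cast_pos.2 i.pos
  have h : (i : ℝ) + 1 ≤ n := by exact_mod_cast i.2
  refine ⟨by unfold equispaced; positivity, ?_⟩
  rw [equispaced, div_le_one (by positivity)]
  linarith

/-- Between two active neighbours the distance is at most half the gap. Beyond the last or before
the first one it is at most (2m+1)/(2n), m being the number of failed sensors on that side; one copy
of m is charged to the longest run, the other to the trailing or leading run. -/
theorem coverageCost_equispaced_le (hA : A.Nonempty) : coverageCost (equispaced n) A
    ≤ ((longestRun A : ℝ) + 1 + leadingRun A + trailingRun A) / (2 * n) := by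
  have hn : (0 : ℝ) < n := by
    obtain ⟨j, -⟩ := hA
    exact Nat.cast_pos.2 j.pos
  set M := longestRun A
  refine coverageCost_le hA fun s hs => ?_
  have hs0 := hs.1
  have hs1 := hs.2
  have hbound : ∀ y : ℝ, 2 * n * y ≤ (M : ℝ) + 1 + leadingRun A + trailingRun A →
      y ≤ ((M : ℝ) + 1 + leadingRun A + trailingRun A) / (2 * n) := by
    intro y h1
    rwa [le_div_iff₀ (by positivity), mul_comm]
  have hpos : ∀ j : Fin n, 2 * n * equispaced n j = 2 * j + 1 := by
    intro j
    unfold equispaced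
    field_simp
  have hL0 : (0 : ℝ) ≤ leadingRun A := Nat.cast_nonneg _
  have hR0 : (0 : ℝ) ≤ trailingRun A := Nat.cast_nonneg _
  have hns0 : 0 ≤ n * s := mul_nonneg hn.le hs0
  have hns1 : n * s ≤ n := mul_le_of_le_one_right hn.le hs1
  by_cases hlo : ∃ j ∈ A, equispaced n j ≤ s
  · by_cases hhi : ∃ j ∈ A, s ≤ equispaced n j
    · obtain ⟨a, ⟨haA, has⟩, hamax⟩ : ∃ a, (a ∈ A ∧ equispaced n a ≤ s) ∧
          ∀ j, j ∈ A → equispaced n j ≤ s → j ≤ a := by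
        obtain ⟨a, ha⟩ := (A.filter fun j => equispaced n j ≤ s).exists_max_image id
          (by obtain ⟨j, hj⟩ := hlo; exact ⟨j, Finset.mem_filter.2 hj⟩)
        exact ⟨a, Finset.mem_filter.1 ha.1,
          fun j h1 h2 => ha.2 j (Finset.mem_filter.2 ⟨h1, h2⟩)⟩
      obtain ⟨b, ⟨hbA, hbs⟩, hbmin⟩ : ∃ b, (b ∈ A ∧ s ≤ equispaced n b) ∧
          ∀ j, j ∈ A → s ≤ equispaced n j → b ≤ j := by
        obtain ⟨b, hb⟩ := (A.filter fun j => s ≤ equispaced n j).exists_min_image id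
          (by obtain ⟨j, hj⟩ := hhi; exact ⟨j, Finset.mem_filter.2 hj⟩)
        exact ⟨b, Finset.mem_filter.1 hb.1,
          fun j h1 h2 => hb.2 j (Finset.mem_filter.2 ⟨h1, h2⟩)⟩
      have hrun : (b : ℕ) - (a + 1) ≤ M := by
        refine le_longestRun ⟨a + 1, by omega, disjoint_window.2 fun j hj => ?_⟩
        rcases le_total (equispaced n j) s with h | h
        · have : (j : ℕ) ≤ a := hamax j hj h
          omega
        · have : (b : ℕ) ≤ j := hbmin j hj h
          omega
      have hba : (b : ℝ) ≤ a + 1 + M := by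
        exact_mod_cast (by omega : (b : ℕ) ≤ a + 1 + M)
      have hpa := hpos a
      have hpb := hpos b
      rcases le_total (s - equispaced n a) (equispaced n b - s) with h | h
      · refine ⟨a, haA, ?_⟩
        rw [abs_of_nonneg (by linarith)]
        refine hbound _ ?_
        have := mul_le_mul_of_nonneg_left h hn.le
        linarith
      · refine ⟨b, hbA, ?_⟩
        rw [abs_of_nonpos (by linarith)]
        refine hbound _ ?_
        have := mul_le_mul_of_nonneg_left h hn.le
        linarith
    · push Not at hhi
      have hr : Disjoint (window n (n - (n - (A.max' hA + 1))) (n - (A.max' hA + 1))) A := by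
        refine disjoint_window.2 fun j hj => ?_
        have : (j : ℕ) ≤ A.max' hA := A.le_max' j hj
        omega
      refine ⟨A.max' hA, A.max'_mem hA, ?_⟩
      have h1 := hhi _ (A.max'_mem hA)
      have hp := hpos (A.max' hA)
      set a := A.max' hA
      have hM : n ≤ M + (a + 1) := by
        have : n - (a + 1) ≤ M := le_longestRun ⟨_, by omega, hr⟩
        omega
      have hR : n ≤ trailingRun A + (a + 1) := by
        have := le_trailingRun (by omega) hr
        omega
      have hM' : (n : ℝ) ≤ M + (a + 1) := by exact_mod_cast hM
      have hR' : (n : ℝ) ≤ trailingRun A + (a + 1) := by exact_mod_cast hR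
      rw [abs_of_nonneg (by linarith)]
      refine hbound _ ?_
      linarith
  · push Not at hlo
    have hr : Disjoint (window n 0 (A.min' hA)) A := by
      refine disjoint_window.2 fun j hj => ?_
      have : (A.min' hA : ℕ) ≤ j := A.min'_le j hj
      omega
    refine ⟨A.min' hA, A.min'_mem hA, ?_⟩
    have h1 := hlo _ (A.min'_mem hA)
    have hp := hpos (A.min' hA)
    set b := A.min' hA
    have hM : ((b : ℕ) : ℝ) ≤ M := by
      exact_mod_cast (le_longestRun ⟨0, by omega, hr⟩ : (b : ℕ) ≤ M)
    have hL : ((b : ℕ) : ℝ) ≤ leadingRun A := by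
      exact_mod_cast le_leadingRun (by omega) hr
    rw [abs_of_nonpos (by linarith)]
    refine hbound _ ?_
    linarith

theorem expectedCost_equispaced_le (hp0 : 0 ≤ p) (hp1 : p < 1) (hn : 0 < n) :
    expectedCost p (equispaced n) ≤ expect p (runCost (n := n)) + p / (1 - p) / n := by
  have hn' : (0 : ℝ) < n := Nat.cast_pos.2 hn
  calc expectedCost p (equispaced n)
      ≤ expect p (fun A : Finset (Fin n) => runCost A
          + 1 / (2 * n) * ((leadingRun A : ℝ) + trailingRun A)) := by
        refine expect_mono hp0 hp1.le fun A => ?_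
        by_cases hA : A.Nonempty
        · refine (coverageCost_equispaced_le hA).trans_eq ?_
          rw [runCost, if_pos hA]
          ring
        · rw [Finset.not_nonempty_iff_eq_empty.1 hA, coverageCost_empty, runCost,
            if_neg Finset.not_nonempty_empty]
          exact le_add_of_nonneg_right (by positivity)
    _ = expect p (runCost (n := n)) + 1 / (2 * n) *
          (expect p (fun A : Finset (Fin n) => (leadingRun A : ℝ))
            + expect p (fun A : Finset (Fin n) => (trailingRun A : ℝ))) := by
        rw [expect_add, expect_const_mul, expect_add]
    _ ≤ expect p (runCost (n := n)) + 1 / (2 * n) * (p / (1 - p) + p / (1 - p)) := by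
        have h1 := expect_leadingRun_le (n := n) hp0 hp1
        have h2 := expect_trailingRun_le (n := n) hp0 hp1
        gcongr
    _ = expect p (runCost (n := n)) + p / (1 - p) / n := by field_simp; ring

theorem le_expect_runCost (hp0 : 0 ≤ p) (hp1 : p ≤ 1) (hn : 0 < n) :
    expect p (fun A : Finset (Fin n) => (longestRun A : ℝ)) / (2 * n)
      ≤ expect p (runCost (n := n)) := by
  have hn' : (0 : ℝ) < n := Nat.cast_pos.2 hn
  rw [div_eq_inv_mul, ← expect_const_mul]
  refine expect_mono hp0 hp1 fun A => ?_
  by_cases hA : A.Nonempty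
  · rw [runCost, if_pos hA, ← div_eq_inv_mul]
    gcongr
    linarith
  -- With no active sensor the left side is n/(2n) = 1/2, below the conventional cost 1.
  · rw [Finset.not_nonempty_iff_eq_empty.1 hA, longestRun_empty, runCost,
      if_neg Finset.not_nonempty_empty]
    field_simp
    norm_num

theorem expect_runCost_le_longestRun (hp0 : 0 ≤ p) (hp1 : p ≤ 1) (hn : 0 < n) :
    expect p (runCost (n := n))
      ≤ (expect p (fun A : Finset (Fin n) => (longestRun A : ℝ)) + 1) / (2 * n) + p ^ n := by
  classical
  have hn' : (0 : ℝ) < n := Nat.cast_pos.2 hn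
  -- The extra p^n pays for the cost 1 of the empty active set.
  have hempty : prob p (fun A : Finset (Fin n) => Disjoint Finset.univ A) = p ^ n := by
    rw [prob_disjoint, Finset.card_univ, Fintype.card_fin]
  have h1 : (expect p (fun A : Finset (Fin n) => (longestRun A : ℝ)) + 1) / (2 * n)
      = expect p (fun A : Finset (Fin n) => (2 * n : ℝ)⁻¹ * ((longestRun A : ℝ) + 1)) := by
    rw [expect_const_mul, expect_add, expect_const, div_eq_inv_mul]
  rw [h1, ← hempty, prob, ← expect_add]
  refine expect_mono hp0 hp1 fun A => ?_
  by_cases hA : A.Nonempty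
  · rw [runCost, if_pos hA, div_eq_inv_mul]
    exact le_add_of_nonneg_right (by split_ifs <;> norm_num)
  · rw [Finset.not_nonempty_iff_eq_empty.1 hA, runCost, if_neg Finset.not_nonempty_empty,
      if_pos (Finset.disjoint_empty_right _)]
    exact le_add_of_nonneg_left (by positivity)

end Cost

/-! ### Asymptotics -/

section Asymptotics

variable {p : ℝ}

theorem expectedCost_equispaced_isBigO (hp0 : 0 < p) (hp1 : p < 1) :
    (fun n : ℕ => expectedCost p (equispaced n) - 1 / (2 * Real.log p⁻¹) * (Real.log n / n))
      =O[atTop] (fun n : ℕ => 1 / (n : ℝ)) := by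
  have hq : 0 < 1 - p := sub_pos.2 hp1
  have hpinv : 1 < p⁻¹ := (one_lt_inv₀ hp0).2 hp1
  have hlog : 0 < Real.log p⁻¹ := Real.log_pos hpinv
  set c := Real.log p⁻¹
  have hev1 : ∀ᶠ n : ℕ in atTop, 2 * (Real.log n / c) ≤ n := by
    have h := (Real.isLittleO_log_id_atTop.comp_tendsto tendsto_natCast_atTop_atTop).bound
      (by positivity : 0 < c / 2)
    filter_upwards [h] with n hn
    simp only [Function.comp_apply, id, Real.norm_eq_abs, Nat.abs_cast] at hn
    have := (le_abs_self _).trans hn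
    rw [← mul_div_assoc, div_le_iff₀ hlog]
    linarith
  have hev2 : ∀ᶠ n : ℕ in atTop, (n : ℝ) * p ^ n ≤ 1 :=
    (tendsto_self_mul_const_pow_of_lt_one hp0.le hp1).eventually (eventually_le_nhds zero_lt_one)
  refine IsBigO.of_bound (2 / (1 - p) ^ 2 + 1 / (1 - p) + p / (1 - p) + 2) ?_
  filter_upwards [hev1, hev2, eventually_gt_atTop 0] with n h1 h2 hn
  have hn' : (0 : ℝ) < n := Nat.cast_pos.2 hn
  have hn1 : (1 : ℝ) ≤ n := by exact_mod_cast hn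
  have hquot : 0 ≤ Real.log n / c := div_nonneg (Real.log_nonneg hn1) hlog.le
  -- K is where n p^k crosses 1: p^(-K) ≤ n makes the lower error bounded, n p^(K+1) ≤ 1 the upper
  -- one.
  set K := ⌊Real.log n / c⌋₊
  have hK1 : (K : ℝ) ≤ Real.log n / c := Nat.floor_le hquot
  have hK2 : Real.log n / c < K + 1 := Nat.lt_floor_add_one _
  have hpow1 : p⁻¹ ^ K ≤ n := by
    rw [← Real.log_le_log_iff (by positivity) hn', Real.log_pow]
    exact (le_div_iff₀ hlog).1 hK1
  have hpow2 : n * p ^ (K + 1) ≤ 1 := by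
    have : (n : ℝ) ≤ p⁻¹ ^ (K + 1) := by
      rw [← Real.log_le_log_iff hn' (by positivity), Real.log_pow]
      push_cast
      exact (div_le_iff₀ hlog).1 hK2.le
    rw [inv_pow] at this
    calc n * p ^ (K + 1) ≤ (p ^ (K + 1))⁻¹ * p ^ (K + 1) := by gcongr
      _ = 1 := inv_mul_cancel₀ (by positivity)
  have hKn : 2 * K ≤ n := by
    have : (2 : ℝ) * K ≤ n := by linarith
    exact_mod_cast this
  have hup := expect_longestRun_le (n := n) hp0.le hp1 K
  have hlow := le_expect_longestRun (n := n) hp0 hp1 hKn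
  have hup' := (expectedCost_equispaced_le hp0.le hp1 hn).trans
    (add_le_add_left (expect_runCost_le_longestRun hp0.le hp1.le hn) _)
  have hlow' := (le_expect_runCost hp0.le hp1.le hn).trans
    (expect_runCost_le hp0.le hp1.le hn (equispaced_mem_Icc (n := n)))
  set m := expect p (fun A : Finset (Fin n) => (longestRun A : ℝ))
  set C := expectedCost p (equispaced n)
  have hm1 : m ≤ Real.log n / c + 1 / (1 - p) := by
    have : n * p ^ (K + 1) / (1 - p) ≤ 1 / (1 - p) := by gcongr
    linarith
  have hm2 : Real.log n / c - 1 - 2 / (1 - p) ^ 2 ≤ m := by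
    have : 2 * p⁻¹ ^ K / (n * (1 - p) ^ 2) ≤ 2 * n / (n * (1 - p) ^ 2) := by gcongr
    have e : 2 * n / (n * (1 - p) ^ 2) = 2 / (1 - p) ^ 2 := by field_simp
    linarith
  have ha : 0 < 2 / (1 - p) ^ 2 := by positivity
  have hb : 0 < 1 / (1 - p) := by positivity
  have hd : 0 < p / (1 - p) := by positivity
  have hCn1 : n * C ≤ (m + 1) / 2 + 1 + p / (1 - p) := by
    have := mul_le_mul_of_nonneg_left hup' hn'.le
    have e : n * ((m + 1) / (2 * n) + p ^ n + p / (1 - p) / n)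
      = (m + 1) / 2 + n * p ^ n + p / (1 - p) := by field_simp
    linarith
  have hCn2 : m / 2 ≤ n * C := by
    have := mul_le_mul_of_nonneg_left hlow' hn'.le
    have e : n * (m / (2 * n)) = m / 2 := by field_simp
    linarith
  have hval : C - 1 / (2 * c) * (Real.log n / n)
      = (n * C - Real.log n / c / 2) * (1 / n) := by field_simp
  rw [hval, norm_mul]
  refine mul_le_mul_of_nonneg_right ?_ (norm_nonneg _)
  rw [Real.norm_eq_abs, abs_le]
  constructor <;> linarith

/-- Both costs are compared with E(`runCost`); the gap obtained is half the stated one. -/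
theorem expectedCost_equispaced_le_of_mem_Icc (hp0 : 0 ≤ p) (hp1 : p < 1) {n : ℕ} (hn : 0 < n)
    {x : Fin n → ℝ} (hx : ∀ i, x i ∈ Set.Icc (0 : ℝ) 1) :
    expectedCost p (equispaced n) ≤ expectedCost p x + p / (1 - p) * (2 / n) := by
  have h1 := expectedCost_equispaced_le hp0 hp1 hn
  have h2 := expect_runCost_le hp0 hp1.le hn hx
  have h3 : p / (1 - p) / n ≤ p / (1 - p) * (2 / n) := by
    have := sub_pos.2 hp1
    rw [div_eq_mul_one_div (p / (1 - p))]
    gcongr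
    norm_num
  linarith

/-- The logarithm in the main term makes the cost dominate the O(1/n) gap to the optimum. -/
theorem tendsto_mul_expectedCost_equispaced (hp0 : 0 < p) (hp1 : p < 1) :
    Tendsto (fun n : ℕ => n * expectedCost p (equispaced n)) atTop atTop := by
  obtain ⟨B, hB⟩ := (expectedCost_equispaced_isBigO hp0 hp1).bound
  have hlog : 0 < Real.log p⁻¹ := Real.log_pos ((one_lt_inv₀ hp0).2 hp1)
  have ht : Tendsto (fun n : ℕ => 1 / (2 * Real.log p⁻¹) * Real.log n - B) atTop atTop :=
    tendsto_atTop_add_const_right _ _ ((Real.tendsto_log_atTop.comp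
      tendsto_natCast_atTop_atTop).const_mul_atTop (by positivity))
  refine tendsto_atTop_mono' _ ?_ ht
  filter_upwards [hB, eventually_gt_atTop 0] with n h hn
  have hn' : (0 : ℝ) < n := Nat.cast_pos.2 hn
  rw [Real.norm_eq_abs, Real.norm_eq_abs, abs_of_pos (by positivity : (0 : ℝ) < 1 / n)] at h
  have := mul_le_mul_of_nonneg_left (abs_le.1 h).1 hn'.le
  have e1 : n * -(B * (1 / n)) = -B := by field_simp
  have e2 : n * (expectedCost p (equispaced n) - 1 / (2 * Real.log p⁻¹) * (Real.log n / n))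
      = n * expectedCost p (equispaced n) - 1 / (2 * Real.log p⁻¹) * Real.log n := by
    field_simp
  linarith

theorem tendsto_expectedCost_ratio (hp0 : 0 < p) (hp1 : p < 1) {x : (n : ℕ) → Fin n → ℝ}
    (hx : ∀ n : ℕ, 1 ≤ n → IsOptimalPlacement p (x n)) :
    Tendsto (fun n : ℕ => expectedCost p (equispaced n) / expectedCost p (x n)) atTop (𝓝 1) := by
  set D := p / (1 - p) * 2
  have hC : Tendsto (fun n : ℕ => n * expectedCost p (equispaced n) - D) atTop atTop :=
    tendsto_atTop_add_const_right _ _ (tendsto_mul_expectedCost_equispaced hp0 hp1)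
  have hgap : ∀ n : ℕ, 0 < n →
      n * expectedCost p (equispaced n) - D ≤ n * expectedCost p (x n) := by
    intro n hn
    have hn' : (0 : ℝ) < n := Nat.cast_pos.2 hn
    have := mul_le_mul_of_nonneg_left
      (expectedCost_equispaced_le_of_mem_Icc hp0.le hp1 hn (hx n hn).1) hn'.le
    have e : n * (expectedCost p (x n) + p / (1 - p) * (2 / n))
        = n * expectedCost p (x n) + D := by simp only [D]; field_simp
    linarith
  have hX : Tendsto (fun n : ℕ => n * expectedCost p (x n)) atTop atTop := by
    refine tendsto_atTop_mono' _ ?_ hC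
    filter_upwards [eventually_gt_atTop 0] with n hn using hgap n hn
  have hupper : Tendsto (fun n : ℕ => 1 + D / (n * expectedCost p (x n))) atTop (𝓝 1) := by
    simpa using (hX.const_div_atTop D).const_add 1
  refine tendsto_of_tendsto_of_tendsto_of_le_of_le' tendsto_const_nhds hupper ?_ ?_
  · filter_upwards [eventually_gt_atTop 0, hX.eventually_gt_atTop 0] with n hn h
    have hpos : 0 < expectedCost p (x n) := pos_of_mul_pos_right h (Nat.cast_nonneg n)
    rw [one_le_div hpos]
    exact (hx n hn).2 _ equispaced_mem_Icc
  · filter_upwards [eventually_gt_atTop 0, hX.eventually_gt_atTop 0] with n hn h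
    have hn' : (0 : ℝ) < n := Nat.cast_pos.2 hn
    have e : expectedCost p (equispaced n) / expectedCost p (x n)
        = (n * expectedCost p (equispaced n)) / (n * expectedCost p (x n)) :=
      (mul_div_mul_left _ _ hn'.ne').symm
    rw [e, div_le_iff₀ h, add_mul, one_mul, div_mul_cancel₀ _ h.ne']
    linarith [hgap n hn]

end Asymptotics

end SensorCoverage

theorem mainTheorem1 (p : ℝ) (hp0 : 0 < p) (hp1 : p < 1) :
    ((fun n : ℕ => SensorCoverage.expectedCost p (SensorCoverage.equispaced n)
        - 1 / (2 * Real.log p⁻¹) * (Real.log n / n))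
      =O[atTop] (fun n : ℕ => 1 / (n : ℝ))) ∧
    (∀ n : ℕ, 1 ≤ n →
      (∃ x : Fin n → ℝ, SensorCoverage.IsOptimalPlacement p x) ∧
      ∀ x : Fin n → ℝ, SensorCoverage.IsOptimalPlacement p x →
        SensorCoverage.expectedCost p (SensorCoverage.equispaced n)
          ≤ SensorCoverage.expectedCost p x + p / (1 - p) * (2 / (n : ℝ))) ∧
    (∀ x : (n : ℕ) → Fin n → ℝ,
      (∀ n : ℕ, 1 ≤ n → SensorCoverage.IsOptimalPlacement p (x n)) →
        Tendsto (fun n : ℕ => SensorCoverage.expectedCost p (SensorCoverage.equispaced n)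
          / SensorCoverage.expectedCost p (x n)) atTop (𝓝 1)) := by
  exact ⟨SensorCoverage.expectedCost_equispaced_isBigO hp0 hp1,
    fun n hn => ⟨SensorCoverage.exists_isOptimalPlacement p n, fun _ hx =>
      SensorCoverage.expectedCost_equispaced_le_of_mem_Icc hp0.le hp1 hn hx.1⟩,
    fun _ hx => SensorCoverage.tendsto_expectedCost_ratio hp0 hp1 hx⟩
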